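/- Let $G$ be a connected graph on the vertex set $\{v_1,\dots,v_n\}$, let $D(G)=(d_G(v_i,v_j))_{i,j}$ be its distance matrix, let $Tr(G)$ be the diagonal matrix whose $i$-th diagonal entry is $Tr_G(v_i)=\sum_{j} d_G(v_i,v_j)$, and let $\rho_Q(G)$, the distance signless Laplacian spectral radius of $G$, be the largest eigenvalue of $Q_D(G)=Tr(G)+D(G)$. Let $n,k$ be integers with $2\le k\le n-2$, and let $\mathfrak{T}(n,k)$ be the set of all trees of order $n$ with exactly $k$ pendant vertices (vertices of degree one). For integers $t_1,t_2\ge 1$ with $t_1+t_2=k$, let $T(n,k;t_1,t_2)$ be the graph obtained from a path $P_\ell$ of order $\ell=n-k\ge 2$ by attaching $t_1$ pendant edges at one end of $P_\ell$ and $t_2$ pendant edges at the other end, and let $\mathfrak{D}(n,k)=\{T(n,k;t_1,t_2) : t_1,t_2\ge 1,\ t_1+t_2=k\}$. **Theorem 3.3.** The maximum of $\rho_Q$ over $\mathfrak{T}(n,k)$ is attained, and every tree $T\in\mathfrak{T}(n,k)$ with $\rho_Q(T)=\max_{T'\in\mathfrak{T}(n,k)}\rho_Q(T')$ belongs to $\mathfrak{D}(n,k)$,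 i.e. is isomorphic to $T(n,k;t_1,t_2)$ for some $t_1,t_2\ge1$ with $t_1+t_2=k$. -/

import Mathlib

namespace DistSignless

/-- The distance matrix `D(G)` (real entries; `G.dist u v` is the graph distance). -/
noncomputable def distMatrix {V : Type*} (G : SimpleGraph V) : Matrix V V ℝ :=
  Matrix.of fun u v => (G.dist u v : ℝ)

/-- The transmission `Tr_G(u)`: the sum of the distances from `u` to all vertices
(the term of `u` itself is `0`). -/
noncomputable def transmission {V : Type*} [Fintype V] (G : SimpleGraph V) (u : V) : ℝ :=
  ∑ v, (G.dist u v : ℝ)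

/-- The distance signless Laplacian matrix `Q_D(G) = Tr(G) + D(G)`. -/
noncomputable def distSignlessLaplacian {V : Type*} [Fintype V] [DecidableEq V]
    (G : SimpleGraph V) : Matrix V V ℝ :=
  Matrix.diagonal (transmission G) + distMatrix G

theorem distSignlessLaplacian_isHermitian {V : Type*} [Fintype V] [DecidableEq V]
    (G : SimpleGraph V) : (distSignlessLaplacian G).IsHermitian := by
  refine Matrix.IsHermitian.add (Matrix.isHermitian_diagonal _) ?_
  ext u v
  simp [distMatrix, SimpleGraph.dist_comm]

/-- The distance signless Laplacian spectral radius `ρ_Q(G)`: the largest eigenvalue of `Q_D(G)`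
(the supremum is a maximum by `rhoQ_isGreatest`). -/
noncomputable def rhoQ {V : Type*} [Fintype V] [DecidableEq V] (G : SimpleGraph V) : ℝ :=
  sSup (spectrum ℝ (distSignlessLaplacian G))

theorem rhoQ_isGreatest {V : Type*} [Fintype V] [DecidableEq V] [Nonempty V]
    (G : SimpleGraph V) : IsGreatest (spectrum ℝ (distSignlessLaplacian G)) (rhoQ G) := by
  have h := (distSignlessLaplacian_isHermitian G).spectrum_real_eq_range_eigenvalues
  have hf : (spectrum ℝ (distSignlessLaplacian G)).Finite := by
    rw [h]; exact Set.finite_range _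
  have hn : (spectrum ℝ (distSignlessLaplacian G)).Nonempty := by
    rw [h]; exact Set.range_nonempty _
  exact ⟨hn.csSup_mem hf, fun x hx => le_csSup hf.bddAbove hx⟩

open Classical in
/-- The pendant vertices of `G`: the vertices of degree one. -/
noncomputable def pendantVertices {V : Type*} [Fintype V] (G : SimpleGraph V) : Finset V :=
  Finset.univ.filter fun v => G.degree v = 1

/-- The trees of order `n` (on the vertex set `Fin n`) with exactly `k` pendant vertices. -/
def treesWithPendants (n k : ℕ) : Set (SimpleGraph (Fin n)) :=
  {T | T.IsTree ∧ (pendantVertices T).card = k}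

/-- Adjacency in the graph obtained from the path on `Fin l` (consecutive numbers are adjacent)
by attaching `t₁` pendant edges at the first vertex `0` and `t₂` at the last vertex `l - 1`. -/
def pathWithPendantsAdj (l t₁ t₂ : ℕ) :
    Fin l ⊕ (Fin t₁ ⊕ Fin t₂) → Fin l ⊕ (Fin t₁ ⊕ Fin t₂) → Prop
  | .inl i, .inl j => (SimpleGraph.pathGraph l).Adj i j
  | .inl i, .inr (.inl _) => i.val = 0
  | .inr (.inl _), .inl i => i.val = 0
  | .inl i, .inr (.inr _) => i.val + 1 = l
  | .inr (.inr _), .inl i => i.val + 1 = l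
  | .inr _, .inr _ => False

/-- The graph obtained from a path of order `l` by attaching `t₁` pendant edges at one end and
`t₂` pendant edges at the other end. -/
def pathWithPendants (l t₁ t₂ : ℕ) : SimpleGraph (Fin l ⊕ (Fin t₁ ⊕ Fin t₂)) where
  Adj := pathWithPendantsAdj l t₁ t₂
  symm := ⟨by
    rintro (i | i | i) (j | j | j) h <;> simp_all [pathWithPendantsAdj, SimpleGraph.adj_comm]⟩
  loopless := ⟨by
    rintro (i | i | i) h <;> simp_all [pathWithPendantsAdj]⟩

/-- `G` belongs (up to isomorphism) to the class `𝔇(n,k)` of all `T(n,k;t₁,t₂)` with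
`t₁, t₂ ≥ 1` and `t₁ + t₂ = k`, where the underlying path has order `l ≥ 2` with `l + k = n`. -/
def InClassD {V : Type*} (n k : ℕ) (G : SimpleGraph V) : Prop :=
  ∃ l t₁ t₂ : ℕ, 2 ≤ l ∧ 1 ≤ t₁ ∧ 1 ≤ t₂ ∧ t₁ + t₂ = k ∧ l + k = n ∧
    Nonempty (G ≃g pathWithPendants l t₁ t₂)

end DistSignless

namespace DistSignless

open Matrix

/-! A maximiser exists because there are finitely many graphs on `Fin n` and the class contains a
broom. For its shape, let `w` have two non-pendant neighbours `c`, `c'` and a further neighbour `b`.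
Re-hang the branch at `b` from `w` onto `c`, or onto `c'`. Both results are trees with the same
pendant vertices. In a tree `2 d(v,w) ≤ d(v,c) + d(v,c')`, so each distance is at most the average
of the two new ones, strictly for the pair `b`, `w`. The quadratic form of `Q_D` is a sum of
distances with weights `x u ^ 2 + x u * x v`, all positive at a Perron vector `x` of the original
tree. Hence one of the two moves raises `ρ_Q` (`rhoQ_lt_or_rhoQ_lt`, `rhoQ_lt_moveEdge`). So in a
maximiser a vertex with two non-pendant neighbours has degree two. The non-pendant vertices then
form a path, and pendant edges sit only at its ends (`inClassD_of_forall_adj`). -/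

/-! ### Quadratic form, Rayleigh's inequality and the Perron vector. -/

theorem distSignlessLaplacian_apply_of_ne {V : Type*} [Fintype V] [DecidableEq V]
    (G : SimpleGraph V) {u v : V} (h : u ≠ v) :
    distSignlessLaplacian G u v = G.dist u v := by
  simp [distSignlessLaplacian, distMatrix, h]

/-- The quadratic form of the distance signless Laplacian. -/
theorem dotProduct_distSignlessLaplacian_mulVec {V : Type*} [Fintype V] [DecidableEq V]
    (G : SimpleGraph V) (x : V → ℝ) :
    x ⬝ᵥ (distSignlessLaplacian G *ᵥ x) =
      ∑ u, ∑ v, (G.dist u v : ℝ) * (x u ^ 2 + x u * x v) := by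
  simp only [distSignlessLaplacian, add_mulVec, mulVec_diagonal, dotProduct, Pi.add_apply]
  refine Finset.sum_congr rfl fun u _ => ?_
  simp only [transmission, mulVec, dotProduct, distMatrix, of_apply]
  rw [Finset.sum_mul, ← Finset.sum_add_distrib, Finset.mul_sum]
  exact Finset.sum_congr rfl fun v _ => by ring

/-- Semidefiniteness gives Rayleigh's inequality together with its equality case: a vector where the
form vanishes lies in the kernel. -/
theorem posSemidef_rhoQ_sub {V : Type*} [Fintype V] [DecidableEq V] [Nonempty V]
    (G : SimpleGraph V) :
    (algebraMap ℝ (Matrix V V ℝ) (rhoQ G) - distSignlessLaplacian G).PosSemidef := by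
  rw [posSemidef_iff_isHermitian_and_spectrum_nonneg]
  refine ⟨IsHermitian.sub ?_ (distSignlessLaplacian_isHermitian G), ?_⟩
  · rw [Matrix.algebraMap_eq_diagonal]
    exact isHermitian_diagonal _
  · rw [← spectrum.singleton_sub_eq]
    rintro _ ⟨a, ha, b, hb, rfl⟩
    rw [Set.mem_singleton_iff] at ha
    have := (rhoQ_isGreatest G).2 hb
    subst ha
    simpa using this

theorem rhoQ_sub_mulVec {V : Type*} [Fintype V] [DecidableEq V] (G : SimpleGraph V) (x : V → ℝ) :
    (algebraMap ℝ (Matrix V V ℝ) (rhoQ G) - distSignlessLaplacian G) *ᵥ x =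
      rhoQ G • x - distSignlessLaplacian G *ᵥ x := by
  rw [sub_mulVec, Algebra.algebraMap_eq_smul_one, smul_mulVec, one_mulVec]

/-- Rayleigh's inequality. -/
theorem dotProduct_mulVec_le_rhoQ {V : Type*} [Fintype V] [DecidableEq V] [Nonempty V]
    (G : SimpleGraph V) (x : V → ℝ) :
    x ⬝ᵥ (distSignlessLaplacian G *ᵥ x) ≤ rhoQ G * (x ⬝ᵥ x) := by
  have h := (posSemidef_rhoQ_sub G).dotProduct_mulVec_nonneg x
  rw [rhoQ_sub_mulVec, dotProduct_sub, dotProduct_smul] at h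
  simpa using h

/-- A connected graph has a positive eigenvector for `ρ_Q`. -/
theorem exists_pos_eigenvector {V : Type*} [Fintype V] [DecidableEq V] [Nonempty V]
    {G : SimpleGraph V} (hG : G.Connected) :
    ∃ x : V → ℝ, (∀ v, 0 < x v) ∧ distSignlessLaplacian G *ᵥ x = rhoQ G • x := by
  have hs := (rhoQ_isGreatest G).1
  rw [← spectrum_toLin', ← Module.End.hasEigenvalue_iff_mem_spectrum] at hs
  obtain ⟨x, hx⟩ := hs.exists_hasEigenvector
  have hxQ : distSignlessLaplacian G *ᵥ x = rhoQ G • x := by simpa using hx.apply_eq_smul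
  have hx0 : x ≠ 0 := hx.2
  -- The matrix has nonnegative entries, so passing to absolute values does not lower the form; `y`
  -- attains the Rayleigh bound and is an eigenvector too.
  set y : V → ℝ := fun v => |x v| with hy
  have hyy : y ⬝ᵥ y = x ⬝ᵥ x := by simp [dotProduct, hy]
  have hle : x ⬝ᵥ (distSignlessLaplacian G *ᵥ x) ≤ y ⬝ᵥ (distSignlessLaplacian G *ᵥ y) := by
    rw [dotProduct_distSignlessLaplacian_mulVec, dotProduct_distSignlessLaplacian_mulVec]
    refine Finset.sum_le_sum fun u _ => Finset.sum_le_sum fun v _ => ?_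
    have : x u * x v ≤ |x u| * |x v| := by rw [← abs_mul]; exact le_abs_self _
    simp only [hy, sq_abs]
    gcongr
  have hge := dotProduct_mulVec_le_rhoQ G y
  rw [hxQ, dotProduct_smul, smul_eq_mul, ← hyy] at hle
  have hz := ((posSemidef_rhoQ_sub G).dotProduct_mulVec_zero_iff y).1 (by
    rw [rhoQ_sub_mulVec, dotProduct_sub, dotProduct_smul]
    simp only [star_trivial, smul_eq_mul]
    linarith)
  rw [rhoQ_sub_mulVec, sub_eq_zero] at hz
  refine ⟨y, fun v => (abs_nonneg _).lt_of_ne' fun hv => hx0 ?_, hz.symm⟩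
  have hv' : y v = 0 := hv
  have h0 := congrFun hz v
  rw [Pi.smul_apply, hv', smul_zero] at h0
  -- If `y v = 0`, row `v` of the eigenvalue equation is a vanishing sum of nonnegative terms.
  -- Connectedness makes the off-diagonal entries positive, so all of `y` vanishes.
  have hnn : ∀ u ∈ Finset.univ, 0 ≤ distSignlessLaplacian G v u * y u := by
    intro u _
    by_cases huv : v = u
    · subst huv; rw [hv']; simp
    · rw [distSignlessLaplacian_apply_of_ne G huv]; positivity
  have h1 := (Finset.sum_eq_zero_iff_of_nonneg hnn).1 h0.symm
  funext u
  by_cases huv : v = u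
  · subst huv; simpa [hy] using hv'
  · have h2 := h1 u (Finset.mem_univ _)
    rw [distSignlessLaplacian_apply_of_ne G huv] at h2
    have := hG.pos_dist_of_ne huv
    have h3 : (G.dist v u : ℝ) ≠ 0 := by positivity
    simpa [hy, h3] using h2

/-- If the distances of `G` are, on average over `G₁` and `G₂`, at most those of `G₁` and `G₂`,
and somewhere strictly so, then `G` does not have the largest `ρ_Q` of the three. -/
theorem rhoQ_lt_or_rhoQ_lt {V : Type*} [Fintype V] [DecidableEq V]
    {G G₁ G₂ : SimpleGraph V} (hG : G.Connected)
    (hd : ∀ u v, 2 * G.dist u v ≤ G₁.dist u v + G₂.dist u v) {a b : V}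
    (hab : 2 * G.dist a b < G₁.dist a b + G₂.dist a b) :
    rhoQ G < rhoQ G₁ ∨ rhoQ G < rhoQ G₂ := by
  have : Nonempty V := ⟨a⟩
  obtain ⟨x, hx, hQ⟩ := exists_pos_eigenvector hG
  by_contra! hcon
  have hxx : 0 ≤ x ⬝ᵥ x := by simpa using dotProduct_star_self_nonneg x
  have h1 := (dotProduct_mulVec_le_rhoQ G₁ x).trans (mul_le_mul_of_nonneg_right hcon.1 hxx)
  have h2 := (dotProduct_mulVec_le_rhoQ G₂ x).trans (mul_le_mul_of_nonneg_right hcon.2 hxx)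
  have h0 : x ⬝ᵥ (distSignlessLaplacian G *ᵥ x) = rhoQ G * (x ⬝ᵥ x) := by
    rw [hQ, dotProduct_smul, smul_eq_mul]
  rw [dotProduct_distSignlessLaplacian_mulVec] at h0 h1 h2
  have hw : ∀ u v, 0 < x u ^ 2 + x u * x v := fun u v =>
    add_pos (pow_pos (hx u) 2) (mul_pos (hx u) (hx v))
  have key : ∑ u, ∑ v, 2 * ((G.dist u v : ℝ) * (x u ^ 2 + x u * x v)) <
      ∑ u, ∑ v, ((G₁.dist u v : ℝ) * (x u ^ 2 + x u * x v) +
        (G₂.dist u v : ℝ) * (x u ^ 2 + x u * x v)) := by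
    have hle : ∀ u v, 2 * ((G.dist u v : ℝ) * (x u ^ 2 + x u * x v)) ≤
        (G₁.dist u v : ℝ) * (x u ^ 2 + x u * x v) +
        (G₂.dist u v : ℝ) * (x u ^ 2 + x u * x v) := fun u v => by
      have : (2 * G.dist u v : ℝ) ≤ G₁.dist u v + G₂.dist u v := mod_cast hd u v
      rw [← mul_assoc, ← add_mul]
      exact mul_le_mul_of_nonneg_right this (hw u v).le
    refine Finset.sum_lt_sum (fun u _ => Finset.sum_le_sum fun v _ => hle u v)
      ⟨a, Finset.mem_univ _, Finset.sum_lt_sum (fun v _ => hle a v) ⟨b, Finset.mem_univ _, ?_⟩⟩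
    have : (2 * G.dist a b : ℝ) < G₁.dist a b + G₂.dist a b := mod_cast hab
    rw [← mul_assoc, ← add_mul]
    exact mul_lt_mul_of_pos_right this (hw a b)
  simp only [Finset.sum_add_distrib, ← Finset.mul_sum] at key
  linarith


/-! ### Pendant vertices and distances in trees. -/

theorem mem_pendantVertices_iff {V : Type*} [Fintype V] {G : SimpleGraph V} {v : V} :
    v ∈ pendantVertices G ↔ ∃! w, G.Adj v w := by
  classical
  rw [← SimpleGraph.degree_eq_one_iff_existsUnique_adj]
  simp [pendantVertices]

theorem eq_of_adj_of_mem_pendantVertices {V : Type*} [Fintype V] {G : SimpleGraph V} {v x y : V}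
    (hv : v ∈ pendantVertices G) (hx : G.Adj v x) (hy : G.Adj v y) : x = y :=
  (mem_pendantVertices_iff.1 hv).unique hx hy

theorem notMem_pendantVertices_of_adj {V : Type*} [Fintype V] {G : SimpleGraph V} {v x y : V}
    (hx : G.Adj v x) (hy : G.Adj v y) (hxy : x ≠ y) : v ∉ pendantVertices G :=
  fun hv => hxy (eq_of_adj_of_mem_pendantVertices hv hx hy)

theorem exists_adj_ne_of_notMem_pendantVertices {V : Type*} [Fintype V] {G : SimpleGraph V}
    {v x : V} (hv : v ∉ pendantVertices G) (hx : G.Adj v x) : ∃ y, G.Adj v y ∧ y ≠ x := by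
  by_contra! h
  exact hv (mem_pendantVertices_iff.2 ⟨x, hx, h⟩)

/-- A function that is `0` at `u` and grows by at most one along each edge is bounded by the
distance from `u`. -/
theorem le_dist_of_lipschitz {V : Type*} {G : SimpleGraph V} (hG : G.Connected) {u : V}
    {f : V → ℕ} (h0 : f u = 0) (hf : ∀ v w, G.Adj v w → f w ≤ f v + 1) (v : V) :
    f v ≤ G.dist u v := by
  obtain ⟨p, hp⟩ := hG.exists_walk_length_eq_dist u v
  have key : ∀ {a b : V} (p : G.Walk a b), f b ≤ f a + p.length := by
    intro a b p
    induction p with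
    | nil => simp
    | cons h p ih =>
      have := hf _ _ h
      rw [SimpleGraph.Walk.length_cons]
      omega
  have := key p
  omega

/-- In a tree, at most one neighbour of a vertex is nearer to a given vertex. -/
theorem eq_of_adj_of_dist_lt {V : Type*} {G : SimpleGraph V} (hG : G.IsTree) {w x y h : V}
    (hx : G.Adj w x) (hy : G.Adj w y) (hdx : G.dist h x < G.dist h w)
    (hdy : G.dist h y < G.dist h w) : x = y := by
  have key : ∀ z, G.Adj w z → G.dist h z < G.dist h w →
      ∃ p : G.Walk w h, p.IsPath ∧ p.snd = z := by
    intro z hz hdz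
    obtain ⟨p, hp⟩ := hG.connected.exists_walk_length_eq_dist z h
    refine ⟨p.cons hz, ?_, by simp⟩
    apply SimpleGraph.Walk.isPath_of_length_eq_dist
    have h1 := SimpleGraph.dist_le (p.cons hz)
    rw [SimpleGraph.Walk.length_cons] at h1 ⊢
    rw [SimpleGraph.dist_comm (v := h)] at hp h1 ⊢
    omega
  obtain ⟨p, hp, rfl⟩ := key x hx hdx
  obtain ⟨q, hq, rfl⟩ := key y hy hdy
  rw [(hG.existsUnique_path w h).unique hp hq]

/-- Along an edge of a tree the distance to `h` changes by exactly one, and it drops towards at most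
one neighbour of `w`. -/
theorem two_mul_dist_le_of_adj {V : Type*} {G : SimpleGraph V} (hG : G.IsTree) {w x y : V}
    (hx : G.Adj w x) (hy : G.Adj w y) (hxy : x ≠ y) (h : V) :
    2 * G.dist h w ≤ G.dist h x + G.dist h y := by
  have h1 := hG.dist_eq_dist_add_one_of_adj h hx
  have h2 := hG.dist_eq_dist_add_one_of_adj h hy
  have h3 : ¬ (G.dist h x < G.dist h w ∧ G.dist h y < G.dist h w) := fun ⟨ha, hb⟩ =>
    hxy (eq_of_adj_of_dist_lt hG hx hy ha hb)
  omega

/-! ### Moving a branch to a neighbouring vertex. -/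

/-- The graph obtained by replacing the edge `wb` by the edge `cb`. -/
def moveEdge {V : Type*} (G : SimpleGraph V) (w b c : V) : SimpleGraph V :=
  G.deleteEdges {s(w, b)} ⊔ SimpleGraph.edge c b

theorem moveEdge_adj {V : Type*} {G : SimpleGraph V} {w b c x y : V} (hcb : c ≠ b) :
    (moveEdge G w b c).Adj x y ↔ (G.Adj x y ∧ s(x, y) ≠ s(w, b)) ∨ s(x, y) = s(c, b) := by
  simp only [moveEdge, SimpleGraph.sup_adj, SimpleGraph.deleteEdges_adj, SimpleGraph.edge_adj,
    Set.mem_singleton_iff, Sym2.eq_iff]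
  grind

section MoveEdge

variable {V : Type*} {G : SimpleGraph V} {w b c : V}

theorem not_reachable_deleteEdges (hG : G.IsTree) (hwb : G.Adj w b) :
    ¬ (G.deleteEdges {s(w, b)}).Reachable w b :=
  SimpleGraph.isBridge_iff.1 (SimpleGraph.isAcyclic_iff_forall_adj_isBridge.1 hG.isAcyclic hwb)

theorem not_reachable_deleteEdges_of_adj (hG : G.IsTree) (hwb : G.Adj w b) (hwc : G.Adj w c)
    (hcb : c ≠ b) : ¬ (G.deleteEdges {s(w, b)}).Reachable c b := fun h =>
  not_reachable_deleteEdges hG hwb <| SimpleGraph.Reachable.trans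
    (SimpleGraph.Adj.reachable (by
      rw [SimpleGraph.deleteEdges_adj]
      refine ⟨hwc, ?_⟩
      simp only [Set.mem_singleton_iff, Sym2.eq_iff]
      rintro (⟨-, h⟩ | ⟨h, -⟩)
      · exact hcb h
      · exact hwb.ne h)) h

theorem moveEdge_isTree (hG : G.IsTree) (hwb : G.Adj w b) (hwc : G.Adj w c) (hcb : c ≠ b) :
    (moveEdge G w b c).IsTree := by
  refine ⟨?_, ?_⟩
  · have := hG.connected.nonempty
    have hadj : ∀ x y, G.Adj x y → (moveEdge G w b c).Reachable x y := by
      have hwb' : (moveEdge G w b c).Reachable w b := by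
        refine SimpleGraph.Reachable.trans (v := c) (SimpleGraph.Adj.reachable ?_)
          (SimpleGraph.Adj.reachable ?_)
        · rw [moveEdge_adj hcb, ne_eq, Sym2.eq_iff, Sym2.eq_iff]
          have := hwb.ne
          grind
        · rw [moveEdge_adj hcb]; exact .inr rfl
      intro x y hxy
      by_cases he : s(x, y) = s(w, b)
      · rcases Sym2.eq_iff.1 he with ⟨rfl, rfl⟩ | ⟨rfl, rfl⟩
        · exact hwb'
        · exact hwb'.symm
      · exact SimpleGraph.Adj.reachable ((moveEdge_adj hcb).2 (.inl ⟨hxy, he⟩))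
    refine ⟨fun x y => ?_⟩
    obtain ⟨p⟩ := hG.connected x y
    induction p with
    | nil => exact SimpleGraph.Reachable.refl _
    | cons h p ih => exact (hadj _ _ h).trans ih
  · exact SimpleGraph.IsAcyclic.sup_edge_of_not_reachable
      (not_reachable_deleteEdges_of_adj hG hwb hwc hcb)
      (hG.isAcyclic.anti (SimpleGraph.deleteEdges_le _))

/-- Moving the branch at `b` from `w` to `c` keeps distances within the branch and outside it, and
the distances between the two parts are at least those measured along the edge `bc`. -/
theorem le_dist_moveEdge (hG : G.IsTree) (hwb : G.Adj w b) (hwc : G.Adj w c) (hcb : c ≠ b)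
    (u v : V) :
    ((G.deleteEdges {s(w, b)}).Reachable b u → (G.deleteEdges {s(w, b)}).Reachable b v →
      G.dist u v ≤ (moveEdge G w b c).dist u v) ∧
    (¬ (G.deleteEdges {s(w, b)}).Reachable b u → ¬ (G.deleteEdges {s(w, b)}).Reachable b v →
      G.dist u v ≤ (moveEdge G w b c).dist u v) ∧
    ((G.deleteEdges {s(w, b)}).Reachable b u → ¬ (G.deleteEdges {s(w, b)}).Reachable b v →
      G.dist u b + 1 + G.dist v c ≤ (moveEdge G w b c).dist u v) := by
  classical
  set B : V → Prop := (G.deleteEdges {s(w, b)}).Reachable b with hB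
  have hT := moveEdge_isTree hG hwb hwc hcb
  have hBb : B b := SimpleGraph.Reachable.refl _
  have hBc : ¬ B c := fun h => not_reachable_deleteEdges_of_adj hG hwb hwc hcb h.symm
  have hcross : ∀ x y, G.Adj x y → s(x, y) ≠ s(w, b) → (B x ↔ B y) := by
    intro x y hxy he
    have : (G.deleteEdges {s(w, b)}).Adj x y := by
      rw [SimpleGraph.deleteEdges_adj]; exact ⟨hxy, he⟩
    exact ⟨fun h => h.trans this.reachable, fun h => h.trans this.symm.reachable⟩
  have hlip : ∀ z x y, G.Adj x y → G.dist z y ≤ G.dist z x + 1 := fun z x y hxy => by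
    have := hG.connected.dist_triangle (u := z) (v := x) (w := y)
    rwa [SimpleGraph.dist_eq_one_iff_adj.2 hxy] at this
  by_cases hu : B u
  -- `f` is the expected distance from `u` in the new tree; only the bound from below is needed, so
  -- it suffices that `f` vanishes at `u` and grows by at most one along each new edge.
  · let f : V → ℕ := fun v => if B v then G.dist u v else G.dist u b + 1 + G.dist v c
    have hf : f v ≤ (moveEdge G w b c).dist u v := by
      refine le_dist_of_lipschitz hT.connected (by simp [f, hu]) (fun x y hxy => ?_) v
      rcases (moveEdge_adj hcb).1 hxy with ⟨hxy, he⟩ | he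
      · have h1 := hcross x y hxy he
        have h2 := hlip u x y hxy
        have h3 := hlip c x y hxy
        rw [SimpleGraph.dist_comm, SimpleGraph.dist_comm (v := x)] at h3
        by_cases hx : B x
        · simpa [f, hx, h1.1 hx] using h2
        · have hy : ¬ B y := fun h => hx (h1.2 h)
          simp only [f, hx, hy, if_false]
          omega
      · rcases Sym2.eq_iff.1 he with ⟨rfl, rfl⟩ | ⟨rfl, rfl⟩
        · simp only [f, hBb, hBc, if_true, if_false]; omega
        · simp only [f, hBb, hBc, if_true, if_false, SimpleGraph.dist_self]; omega
    refine ⟨fun _ hv => ?_, fun h => absurd hu h, fun _ hv => ?_⟩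
    · simpa [f, hv] using hf
    · simpa [f, hv] using hf
  · let f : V → ℕ := fun v => if B v then G.dist u c + 1 + G.dist v b else G.dist u v
    have hf : f v ≤ (moveEdge G w b c).dist u v := by
      refine le_dist_of_lipschitz hT.connected (by simp [f, hu]) (fun x y hxy => ?_) v
      rcases (moveEdge_adj hcb).1 hxy with ⟨hxy, he⟩ | he
      · have h1 := hcross x y hxy he
        have h2 := hlip u x y hxy
        have h3 := hlip b x y hxy
        rw [SimpleGraph.dist_comm, SimpleGraph.dist_comm (v := x)] at h3
        by_cases hx : B x
        · simp only [f, hx, h1.1 hx, if_true]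
          omega
        · have hy : ¬ B y := fun h => hx (h1.2 h)
          simpa [f, hx, hy] using h2
      · rcases Sym2.eq_iff.1 he with ⟨rfl, rfl⟩ | ⟨rfl, rfl⟩
        · simp only [f, hBb, hBc, if_true, if_false, SimpleGraph.dist_self]; omega
        · simp only [f, hBb, hBc, if_true, if_false]; omega
    refine ⟨fun h => absurd h hu, fun _ hv => ?_, fun h => absurd h hu⟩
    simpa [f, hv] using hf

/-- Only the degrees of `w` and `c` change: `w` keeps `c` and `c'`, and `c`, not being pendant, only
gains a neighbour. The vertex `b` trades `w` for `c`. -/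
theorem pendantVertices_moveEdge [Fintype V] (hG : G.IsTree) (hwb : G.Adj w b) (hwc : G.Adj w c)
    (hcb : c ≠ b) {c' : V} (hwc' : G.Adj w c') (hcb' : c' ≠ b) (hcc' : c ≠ c')
    (hc : c ∉ pendantVertices G) :
    pendantVertices (moveEdge G w b c) = pendantVertices G := by
  -- A tree has no triangle: the adjacent vertices `w` and `b` cannot both be at distance one from
  -- `c`.
  have hcb_adj : ¬ G.Adj c b := fun h => by
    have h1 := (hG.dist_ne_of_adj c hwb)
    rw [SimpleGraph.dist_eq_one_iff_adj.2 h, SimpleGraph.dist_eq_one_iff_adj.2 hwc.symm] at h1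
    exact h1 rfl
  obtain ⟨y, hcy, hyw⟩ := exists_adj_ne_of_notMem_pendantVertices hc hwc.symm
  have hwb_ne := hwb.ne
  have hwc_ne := hwc.ne
  ext v
  by_cases hv1 : v = w
  · subst hv1
    refine iff_of_false ?_ ?_
    · refine notMem_pendantVertices_of_adj (x := c) (y := c') ?_ ?_ hcc' <;>
      · rw [moveEdge_adj hcb, ne_eq, Sym2.eq_iff, Sym2.eq_iff]
        grind
    · exact notMem_pendantVertices_of_adj hwc hwc' hcc'
  by_cases hv2 : v = c
  · subst hv2
    refine iff_of_false ?_ hc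
    refine notMem_pendantVertices_of_adj (x := w) (y := y) ?_ ?_ hyw.symm <;>
    · rw [moveEdge_adj hcb, ne_eq, Sym2.eq_iff, Sym2.eq_iff]
      grind [G.adj_comm]
  rw [mem_pendantVertices_iff, mem_pendantVertices_iff]
  by_cases hv3 : v = b
  · subst hv3
    have hN : ∀ z, (moveEdge G w v c).Adj v z ↔ (G.Adj v z ∧ z ≠ w) ∨ z = c := by
      intro z
      rw [moveEdge_adj hcb, ne_eq, Sym2.eq_iff, Sym2.eq_iff]
      grind
    simp only [hN]
    constructor
    · rintro ⟨z, -, hz⟩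
      refine ⟨w, hwb.symm, fun t ht => ?_⟩
      by_contra htw
      have h1 := hz t (.inl ⟨ht, htw⟩)
      have h2 := hz c (.inr rfl)
      exact hcb_adj (by rw [h2, ← h1]; exact ht.symm)
    · intro h
      refine ⟨c, .inr rfl, ?_⟩
      rintro t (⟨ht, htw⟩ | rfl)
      · exact absurd (h.unique ht hwb.symm) htw
      · rfl
  · have hN : ∀ z, (moveEdge G w b c).Adj v z ↔ G.Adj v z := by
      intro z
      rw [moveEdge_adj hcb, ne_eq, Sym2.eq_iff, Sym2.eq_iff]
      grind
    simp only [hN]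

end MoveEdge

/-- If `w` has, besides `b`, two neighbours `c` and `c'`, then moving the edge `wb` to one of `c`
and `c'` increases `ρ_Q`. -/
theorem rhoQ_lt_moveEdge {V : Type*} [Fintype V] [DecidableEq V] {G : SimpleGraph V}
    {w b c c' : V} (hG : G.IsTree) (hwb : G.Adj w b) (hwc : G.Adj w c) (hwc' : G.Adj w c')
    (hcb : c ≠ b) (hcb' : c' ≠ b) (hcc' : c ≠ c') :
    rhoQ G < rhoQ (moveEdge G w b c) ∨ rhoQ G < rhoQ (moveEdge G w b c') := by
  have hcross : ∀ u v, (G.deleteEdges {s(w, b)}).Reachable b u →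
      ¬ (G.deleteEdges {s(w, b)}).Reachable b v →
      2 * (G.dist u b + 1 + G.dist w v) ≤
        (moveEdge G w b c).dist u v + (moveEdge G w b c').dist u v := by
    intro u v hu hv
    have h1 := (le_dist_moveEdge hG hwb hwc hcb u v).2.2 hu hv
    have h2 := (le_dist_moveEdge hG hwb hwc' hcb' u v).2.2 hu hv
    have h3 := two_mul_dist_le_of_adj hG hwc hwc' hcc' v
    rw [SimpleGraph.dist_comm (u := w)]
    omega
  have hcross' : ∀ u v, (G.deleteEdges {s(w, b)}).Reachable b u →
      ¬ (G.deleteEdges {s(w, b)}).Reachable b v →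
      2 * G.dist u v ≤ (moveEdge G w b c).dist u v + (moveEdge G w b c').dist u v := by
    intro u v hu hv
    have h1 := hG.connected.dist_triangle (u := u) (v := b) (w := v)
    have h2 := hG.connected.dist_triangle (u := b) (v := w) (w := v)
    rw [SimpleGraph.dist_eq_one_iff_adj.2 hwb.symm] at h2
    have h3 := hcross u v hu hv
    omega
  have hBw : ¬ (G.deleteEdges {s(w, b)}).Reachable b w :=
    fun h => not_reachable_deleteEdges hG hwb h.symm
  refine rhoQ_lt_or_rhoQ_lt hG.connected (fun u v => ?_) (a := b) (b := w) ?_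
  · by_cases hu : (G.deleteEdges {s(w, b)}).Reachable b u <;>
      by_cases hv : (G.deleteEdges {s(w, b)}).Reachable b v
    · have h1 := (le_dist_moveEdge hG hwb hwc hcb u v).1 hu hv
      have h2 := (le_dist_moveEdge hG hwb hwc' hcb' u v).1 hu hv
      omega
    · exact hcross' u v hu hv
    · rw [SimpleGraph.dist_comm, SimpleGraph.dist_comm (u := u),
        SimpleGraph.dist_comm (G := moveEdge G w b c') (u := u)]
      exact hcross' v u hv hu
    · have h1 := (le_dist_moveEdge hG hwb hwc hcb u v).2.1 hu hv
      have h2 := (le_dist_moveEdge hG hwb hwc' hcb' u v).2.1 hu hv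
      omega
  · have h1 := (le_dist_moveEdge hG hwb hwc hcb b w).2.2 (SimpleGraph.Reachable.refl _) hBw
    have h2 := (le_dist_moveEdge hG hwb hwc' hcb' b w).2.2 (SimpleGraph.Reachable.refl _) hBw
    rw [SimpleGraph.dist_eq_one_iff_adj.2 hwc] at h1
    rw [SimpleGraph.dist_eq_one_iff_adj.2 hwc'] at h2
    rw [SimpleGraph.dist_eq_one_iff_adj.2 hwb.symm]
    omega

/-- In a tree maximising `ρ_Q`, a vertex with two non-pendant neighbours has no further
neighbour. -/
theorem adj_eq_or_eq_of_isMaxOn {n k : ℕ} {T : SimpleGraph (Fin n)}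
    (hT : T ∈ treesWithPendants n k) (hmax : IsMaxOn rhoQ (treesWithPendants n k) T)
    {w b c c' : Fin n} (hwc : T.Adj w c) (hwc' : T.Adj w c') (hcc' : c ≠ c')
    (hc : c ∉ pendantVertices T) (hc' : c' ∉ pendantVertices T) (hwb : T.Adj w b) :
    b = c ∨ b = c' := by
  by_contra! hb
  obtain ⟨hcb, hcb'⟩ := hb
  rcases rhoQ_lt_moveEdge hT.1 hwb hwc hwc' hcb.symm hcb'.symm hcc' with h | h
  · refine (hmax (a := moveEdge T w b c)
      ⟨moveEdge_isTree hT.1 hwb hwc hcb.symm, ?_⟩).not_gt h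
    rw [pendantVertices_moveEdge hT.1 hwb hwc hcb.symm hwc' hcb'.symm hcc' hc]
    exact hT.2
  · refine (hmax (a := moveEdge T w b c')
      ⟨moveEdge_isTree hT.1 hwb hwc' hcb'.symm, ?_⟩).not_gt h
    rw [pendantVertices_moveEdge hT.1 hwb hwc' hcb'.symm hwc hcb.symm hcc'.symm hc']
    exact hT.2


/-! ### Recognising a path with pendant edges at its ends. -/

/-- At most one neighbour of `v` is nearer to `u`, and `v` has at least two neighbours. -/
theorem exists_adj_dist_eq_add_one {V : Type*} [Fintype V] [Nontrivial V] {G : SimpleGraph V}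
    (hG : G.IsTree) {v : V} (hv : v ∉ pendantVertices G) (u : V) :
    ∃ y, G.Adj v y ∧ G.dist u y = G.dist u v + 1 := by
  obtain ⟨x, hx⟩ : ∃ x, G.Adj v x := by
    obtain ⟨z, hz⟩ := exists_ne v
    obtain ⟨p⟩ := hG.connected v z
    cases p with
    | nil => exact absurd rfl hz
    | cons h _ => exact ⟨_, h⟩
  obtain ⟨y, hy, hyx⟩ := exists_adj_ne_of_notMem_pendantVertices hv hx
  by_contra! hcon
  have h1 := hG.dist_eq_dist_add_one_of_adj u hx
  have h2 := hG.dist_eq_dist_add_one_of_adj u hy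
  have h3 := hcon x hx
  have h4 := hcon y hy
  exact hyx (eq_of_adj_of_dist_lt (h := u) hG hy hx (by omega) (by omega))

/-- A tree with two non-pendant vertices contains two pendant vertices at distance at least `3`. -/
theorem exists_pendantVertices_three_le_dist {V : Type*} [Fintype V] {G : SimpleGraph V}
    (hG : G.IsTree) {u v : V} (huv : u ≠ v) (hu : u ∉ pendantVertices G)
    (hv : v ∉ pendantVertices G) :
    ∃ a ∈ pendantVertices G, ∃ c ∈ pendantVertices G, 3 ≤ G.dist a c := by
  have : Nontrivial V := ⟨u, v, huv⟩
  obtain ⟨⟨a, c⟩, hac⟩ := Finite.exists_max fun q : V × V => G.dist q.1 q.2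
  -- Extending beyond `u` and then beyond `v` gives a pair at distance `d(u,v) + 2 ≥ 3`. A farthest
  -- pair is at least that far apart, and its ends are pendant since they cannot be extended.
  obtain ⟨u', -, hu'⟩ := exists_adj_dist_eq_add_one hG hu v
  obtain ⟨v', -, hv'⟩ := exists_adj_dist_eq_add_one hG hv u'
  have h0 := hG.connected.pos_dist_of_ne huv.symm
  rw [SimpleGraph.dist_comm (u := u') (v := v)] at hv'
  have h3 := hac (u', v')
  simp only at h3
  refine ⟨a, ?_, c, ?_, by omega⟩
  · by_contra ha
    obtain ⟨y, -, hy⟩ := exists_adj_dist_eq_add_one hG ha c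
    have := hac (y, c)
    simp only at this
    rw [SimpleGraph.dist_comm, SimpleGraph.dist_comm (u := a)] at this
    omega
  · by_contra hc
    obtain ⟨y, -, hy⟩ := exists_adj_dist_eq_add_one hG hc a
    have := hac (a, y)
    simp only at this
    omega

theorem dist_getVert_of_length_eq_dist {V : Type*} {G : SimpleGraph V} (hG : G.Connected) {a c : V}
    (p : G.Walk a c) (hp : p.length = G.dist a c) {i : ℕ} (hi : i ≤ p.length) :
    G.dist a (p.getVert i) = i := by
  have h1 := SimpleGraph.dist_le (p.take i)
  have h2 := SimpleGraph.dist_le (p.drop i)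
  have h3 := hG.dist_triangle (u := a) (v := p.getVert i) (w := c)
  rw [SimpleGraph.Walk.take_length] at h1
  rw [SimpleGraph.Walk.drop_length] at h2
  omega

/-- A tree with two non-pendant vertices, in which a vertex with two non-pendant neighbours has no
further neighbour, is a path with pendant edges attached at its ends. -/
theorem inClassD_of_forall_adj {V : Type*} [Fintype V] {G : SimpleGraph V} (hG : G.IsTree)
    (hcard : (pendantVertices G).card + 2 ≤ Fintype.card V)
    (H : ∀ w b c c', G.Adj w c → G.Adj w c' → c ≠ c' → c ∉ pendantVertices G →
      c' ∉ pendantVertices G → G.Adj w b → b = c ∨ b = c') :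
    InClassD (Fintype.card V) (pendantVertices G).card G := by
  classical
  obtain ⟨u, hu, v, hv, huv⟩ : ∃ u ∈ (pendantVertices G)ᶜ, ∃ v ∈ (pendantVertices G)ᶜ, u ≠ v := by
    rw [← Finset.one_lt_card, Finset.card_compl]
    omega
  rw [Finset.mem_compl] at hu hv
  obtain ⟨a, ha, c, hc, hac⟩ := exists_pendantVertices_three_le_dist hG huv hu hv
  obtain ⟨p, hp⟩ := hG.connected.exists_walk_length_eq_dist a c
  -- The geodesic has `l` inner vertices `P 1, …, P l`, none of them pendant; they become the path
  -- of the target graph.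
  obtain ⟨l, hl⟩ : ∃ l, p.length = l + 1 := ⟨p.length - 1, by omega⟩
  have hl2 : 2 ≤ l := by omega
  set P : ℕ → V := p.getVert with hP
  have hP0 : P 0 = a := p.getVert_zero
  have hPl : P (l + 1) = c := by rw [hP, ← hl]; exact p.getVert_length
  have hdist : ∀ i ≤ l + 1, G.dist a (P i) = i := fun i hi =>
    dist_getVert_of_length_eq_dist hG.connected p hp (by omega)
  have hinj : ∀ i j, i ≤ l + 1 → j ≤ l + 1 → P i = P j → i = j := fun i j hi hj h => by
    rw [← hdist i hi, ← hdist j hj, h]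
  have hsucc : ∀ i ≤ l, G.Adj (P i) (P (i + 1)) := fun i hi =>
    p.adj_getVert_succ (by omega)
  have hadj : ∀ i j, i ≤ l + 1 → j ≤ l + 1 → (G.Adj (P i) (P j) ↔ i + 1 = j ∨ j + 1 = i) := by
    intro i j hi hj
    constructor
    · intro h
      have := hG.dist_eq_dist_add_one_of_adj a h
      rw [hdist i hi, hdist j hj] at this
      omega
    · rintro (rfl | rfl)
      · exact hsucc i (by omega)
      · exact (hsucc j (by omega)).symm
  have hnp : ∀ i < l, P (i + 1) ∉ pendantVertices G := fun i hi =>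
    notMem_pendantVertices_of_adj (hsucc i (by omega)).symm (hsucc (i + 1) (by omega))
      fun h => by have := hinj _ _ (by omega) (by omega) h; omega
  let L₁ : Finset V := (pendantVertices G).filter fun x => G.Adj x (P 1)
  let L₂ : Finset V := (pendantVertices G).filter fun x => G.Adj x (P l)
  have hL₁ : ∀ x ∈ L₁, x ∈ pendantVertices G ∧ G.Adj x (P 1) := fun x hx => Finset.mem_filter.1 hx
  have hL₂ : ∀ x ∈ L₂, x ∈ pendantVertices G ∧ G.Adj x (P l) := fun x hx => Finset.mem_filter.1 hx
  have haL : a ∈ L₁ := Finset.mem_filter.2 ⟨ha, by rw [← hP0]; exact hsucc 0 (by omega)⟩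
  have hcL : c ∈ L₂ := Finset.mem_filter.2 ⟨hc, by rw [← hPl]; exact (hsucc l le_rfl).symm⟩
  have hdisj : Disjoint L₁ L₂ := by
    rw [Finset.disjoint_left]
    intro x h1 h2
    have := hinj _ _ (by omega) (by omega)
      (eq_of_adj_of_mem_pendantVertices (hL₁ x h1).1 (hL₁ x h1).2 (hL₂ x h2).2)
    omega
  let e₁ := L₁.equivFin.symm
  let e₂ := L₂.equivFin.symm
  let g : Fin l ⊕ (Fin L₁.card ⊕ Fin L₂.card) → V :=
    Sum.elim (fun i => P (i + 1)) (Sum.elim (fun x => (e₁ x : V)) fun x => (e₂ x : V))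
  have hg₁ : ∀ x, (e₁ x : V) ∈ pendantVertices G ∧ G.Adj (e₁ x) (P 1) := fun x => hL₁ _ (e₁ x).2
  have hg₂ : ∀ x, (e₂ x : V) ∈ pendantVertices G ∧ G.Adj (e₂ x) (P l) := fun x => hL₂ _ (e₂ x).2
  have hginj : Function.Injective g := by
    rintro (i | i | i) (j | j | j) h <;> simp only [g, Sum.elim_inl, Sum.elim_inr] at h
    · have := hinj _ _ (by omega) (by omega) h
      congr 1; ext; omega
    · exact absurd (h ▸ (hg₁ j).1) (hnp i i.2)
    · exact absurd (h ▸ (hg₂ j).1) (hnp i i.2)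
    · exact absurd (h ▸ (hg₁ i).1) (hnp j j.2)
    · rw [e₁.injective (Subtype.ext h)]
    · exact absurd (h ▸ (e₂ j).2) (Finset.disjoint_left.1 hdisj (e₁ i).2)
    · exact absurd (h ▸ (hg₂ i).1) (hnp j j.2)
    · exact absurd (h ▸ (e₂ i).2) (Finset.disjoint_left.1 hdisj (e₁ j).2)
    · rw [e₂.injective (Subtype.ext h)]
  have hr₁ : ∀ x ∈ L₁, x ∈ Set.range g := fun x hx =>
    ⟨.inr (.inl (e₁.symm ⟨x, hx⟩)), by simp [g]⟩
  have hr₂ : ∀ x ∈ L₂, x ∈ Set.range g := fun x hx =>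
    ⟨.inr (.inr (e₂.symm ⟨x, hx⟩)), by simp [g]⟩
  have hrP : ∀ i < l, P (i + 1) ∈ Set.range g := fun i hi => ⟨.inl ⟨i, hi⟩, rfl⟩
  have hrP' : ∀ i ≤ l + 1, P i ∈ Set.range g := by
    intro i hi
    rcases Nat.eq_zero_or_pos i with rfl | h0
    · rw [hP0]; exact hr₁ a haL
    · rcases hi.eq_or_lt with rfl | h1
      · rw [hPl]; exact hr₂ c hcL
      · obtain ⟨j, rfl⟩ := Nat.exists_eq_add_of_lt h0
        simpa using hrP j (by omega)
  -- By connectedness, surjectivity of `g` reduces to closure of its range under adjacency, and this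
  -- is where `H` enters.
  have hclosed : ∀ x y, G.Adj x y → x ∈ Set.range g → y ∈ Set.range g := by
    rintro _ y hxy ⟨i | i | i, rfl⟩ <;> simp only [g, Sum.elim_inl, Sum.elim_inr] at hxy
    · have hi := i.2
      by_cases hy : y ∈ pendantVertices G
      · by_cases h0 : (i : ℕ) = 0
        · exact hr₁ y (Finset.mem_filter.2 ⟨hy, by simpa [h0] using hxy.symm⟩)
        by_cases h1 : (i : ℕ) + 1 = l
        · exact hr₂ y (Finset.mem_filter.2 ⟨hy, by simpa [h1] using hxy.symm⟩)
        -- Strictly inside the path both path neighbours are non-pendant, so `H` leaves no room for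
        -- a pendant `y` elsewhere.
        obtain ⟨j, hj⟩ : ∃ j, (i : ℕ) = j + 1 := ⟨i - 1, by omega⟩
        rcases H _ y (P i) (P (i + 1 + 1)) (hsucc i (by omega)).symm (hsucc (i + 1) (by omega))
          (fun h => by have := hinj _ _ (by omega) (by omega) h; omega)
          (by rw [hj]; exact hnp j (by omega)) (hnp _ (by omega)) hxy with rfl | rfl
        · exact hrP' _ (by omega)
        · exact hrP' _ (by omega)
      -- A non-pendant `y` off the geodesic and one non-pendant path neighbour are two such
      -- neighbours, so `H` excludes the other path neighbour (`c` itself when `i + 1 = l`).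
      · by_contra hyr
        have hne : ∀ j ≤ l + 1, y ≠ P j := fun j hj h => hyr (h ▸ hrP' j hj)
        by_cases h1 : (i : ℕ) + 1 = l
        · obtain ⟨j, hj⟩ : ∃ j, (i : ℕ) = j + 1 := ⟨i - 1, by omega⟩
          have := H _ (P (i + 1 + 1)) y (P i) hxy (hsucc i (by omega)).symm (hne _ (by omega)) hy
            (by rw [hj]; exact hnp j (by omega)) (hsucc (i + 1) (by omega))
          rcases this with h | h
          · exact hne _ (by omega) h.symm
          · have := hinj _ _ (by omega) (by omega) h; omega
        · have := H _ (P i) y (P (i + 1 + 1)) hxy (hsucc (i + 1) (by omega)) (hne _ (by omega)) hy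
            (hnp _ (by omega)) (hsucc i (by omega)).symm
          rcases this with h | h
          · exact hne _ (by omega) h.symm
          · have := hinj _ _ (by omega) (by omega) h; omega
    · rw [eq_of_adj_of_mem_pendantVertices (hg₁ i).1 hxy (hg₁ i).2]
      exact hrP' _ (by omega)
    · rw [eq_of_adj_of_mem_pendantVertices (hg₂ i).1 hxy (hg₂ i).2]
      exact hrP' _ (by omega)
  have hsurj : Function.Surjective g := by
    intro y
    obtain ⟨q⟩ := hG.connected a y
    have key : ∀ {s t : V} (q : G.Walk s t), s ∈ Set.range g → t ∈ Set.range g := by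
      intro s t q
      induction q with
      | nil => exact id
      | cons h q ih => exact fun hs => ih (hclosed _ _ h hs)
    exact key q (hr₁ a haL)
  have hgadj : ∀ x y, G.Adj (g x) (g y) ↔ (pathWithPendants l L₁.card L₂.card).Adj x y := by
    have hPL₁ : ∀ (i : Fin l) x, G.Adj (P (i + 1)) (e₁ x) ↔ i.val = 0 := by
      refine fun i x => ⟨fun h => ?_, fun h => by simpa [h] using (hg₁ x).2.symm⟩
      have := hinj _ _ (by omega) (by omega)
        (eq_of_adj_of_mem_pendantVertices (hg₁ x).1 h.symm (hg₁ x).2)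
      omega
    have hPL₂ : ∀ (i : Fin l) x, G.Adj (P (i + 1)) (e₂ x) ↔ i.val + 1 = l := by
      refine fun i x => ⟨fun h => ?_, fun h => by simpa [h] using (hg₂ x).2.symm⟩
      exact hinj _ _ (by omega) (by omega)
        (eq_of_adj_of_mem_pendantVertices (hg₂ x).1 h.symm (hg₂ x).2)
    have hLL₁ : ∀ x z, z ∈ pendantVertices G → ¬ G.Adj (e₁ x) z := fun x z hz h => by
      rw [eq_of_adj_of_mem_pendantVertices (hg₁ x).1 h (hg₁ x).2] at hz
      exact hnp 0 (by omega) hz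
    have hLL₂ : ∀ x z, z ∈ pendantVertices G → ¬ G.Adj (e₂ x) z := fun x z hz h => by
      rw [eq_of_adj_of_mem_pendantVertices (hg₂ x).1 h (hg₂ x).2] at hz
      obtain ⟨j, rfl⟩ : ∃ j, l = j + 1 := ⟨l - 1, by omega⟩
      exact hnp j (by omega) hz
    rintro (i | i | i) (j | j | j) <;>
      simp only [g, Sum.elim_inl, Sum.elim_inr, pathWithPendants, pathWithPendantsAdj]
    · rw [hadj _ _ (by omega) (by omega), SimpleGraph.pathGraph_adj]
      omega
    · exact hPL₁ i j
    · exact hPL₂ i j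
    · rw [G.adj_comm]; exact hPL₁ j i
    · exact iff_of_false (hLL₁ i _ (hg₁ j).1) id
    · exact iff_of_false (hLL₁ i _ (hg₂ j).1) id
    · rw [G.adj_comm]; exact hPL₂ j i
    · exact iff_of_false (hLL₂ i _ (hg₁ j).1) id
    · exact iff_of_false (hLL₂ i _ (hg₂ j).1) id
  have hpend : L₁.card + L₂.card = (pendantVertices G).card := by
    rw [← Finset.card_union_of_disjoint hdisj]
    congr 1
    ext x
    refine ⟨fun h => ?_, fun h => ?_⟩
    · rcases Finset.mem_union.1 h with h | h
      · exact (hL₁ x h).1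
      · exact (hL₂ x h).1
    · obtain ⟨i | i | i, rfl⟩ := hsurj x
      · exact absurd h (hnp i i.2)
      · exact Finset.mem_union_left _ (e₁ i).2
      · exact Finset.mem_union_right _ (e₂ i).2
  let e := Equiv.ofBijective g ⟨hginj, hsurj⟩
  have hV := Fintype.card_congr e
  simp only [Fintype.card_sum, Fintype.card_fin] at hV
  refine ⟨l, L₁.card, L₂.card, hl2, Finset.card_pos.2 ⟨a, haL⟩, Finset.card_pos.2 ⟨c, hcL⟩,
    hpend, by omega, ⟨SimpleGraph.Iso.symm ⟨e, ?_⟩⟩⟩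
  intro x y
  exact hgadj x y


/-! ### Brooms: the class of trees is nonempty. -/

/-- The broom: the path `0, 1, …, m` with all vertices larger than `m` attached at `m`. -/
def broom (n m : ℕ) : SimpleGraph (Fin n) :=
  SimpleGraph.fromRel fun i j => i.val + 1 ≤ j.val ∧ i.val = min (j.val - 1) m

theorem broom_adj {n m : ℕ} {i j : Fin n} :
    (broom n m).Adj i j ↔ (i.val + 1 ≤ j.val ∧ i.val = min (j.val - 1) m) ∨
      (j.val + 1 ≤ i.val ∧ j.val = min (i.val - 1) m) := by
  rw [broom, SimpleGraph.fromRel_adj]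
  refine ⟨And.right, fun h => ⟨?_, h⟩⟩
  rintro rfl
  omega

/-- Each `j > 0` has the smaller parent `min (j - 1) m`: descending reaches `0`, and there are at
most `n - 1` edges. -/
theorem broom_isTree {n m : ℕ} (hn : 0 < n) : (broom n m).IsTree := by
  classical
  have : Nonempty (Fin n) := ⟨⟨0, hn⟩⟩
  have hreach : ∀ (j : ℕ) (hj : j < n), (broom n m).Reachable ⟨0, hn⟩ ⟨j, hj⟩ := by
    intro j
    induction j using Nat.strong_induction_on with
    | _ j ih =>
      intro hj
      rcases Nat.eq_zero_or_pos j with rfl | h0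
      · exact SimpleGraph.Reachable.refl _
      · have hlt : min (j - 1) m < j := by omega
        exact (ih _ hlt (hlt.trans hj)).trans
          (SimpleGraph.Adj.reachable (broom_adj.2 (.inl ⟨by simp only; omega, rfl⟩)))
  have hconn : (broom n m).Connected :=
    ⟨fun i j => (hreach i i.2).symm.trans (hreach j j.2)⟩
  rw [SimpleGraph.isTree_iff_connected_and_card]
  refine ⟨hconn, le_antisymm ?_ hconn.card_vert_le_card_edgeSet_add_one⟩
  let par : Fin n → Fin n := fun j => ⟨min (j.val - 1) m, by omega⟩
  have hsub : (broom n m).edgeFinset ⊆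
      (Finset.univ.erase (⟨0, hn⟩ : Fin n)).image fun j => s(par j, j) := by
    intro e he
    induction e with
    | _ i j =>
      rw [SimpleGraph.mem_edgeFinset, SimpleGraph.mem_edgeSet, broom_adj] at he
      rw [Finset.mem_image]
      rcases he with h | h
      · refine ⟨j, Finset.mem_erase.2 ⟨?_, Finset.mem_univ _⟩, ?_⟩
        · rintro rfl; simp at h
        · rw [show par j = i from Fin.ext h.2.symm]
      · refine ⟨i, Finset.mem_erase.2 ⟨?_, Finset.mem_univ _⟩, ?_⟩
        · rintro rfl; simp at h
        · rw [show par i = j from Fin.ext h.2.symm, Sym2.eq_swap]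
  have := (Finset.card_le_card hsub).trans Finset.card_image_le
  rw [Finset.card_erase_of_mem (Finset.mem_univ _), Finset.card_univ, Fintype.card_fin] at this
  rw [Nat.card_eq_fintype_card, Nat.card_eq_fintype_card, Fintype.card_fin,
    ← SimpleGraph.edgeFinset_card]
  omega

theorem mem_pendantVertices_broom {n m : ℕ} (hm : 1 ≤ m) (hmn : m + 1 < n) (i : Fin n) :
    i ∈ pendantVertices (broom n m) ↔ i.val = 0 ∨ m < i.val := by
  have hi := i.2
  constructor
  · intro h
    by_contra! hcon
    refine notMem_pendantVertices_of_adj (G := broom n m) (x := ⟨i - 1, by omega⟩)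
      (y := ⟨i + 1, by omega⟩) (broom_adj.2 (.inr ?_)) (broom_adj.2 (.inl ?_)) ?_ h
    · simp only; omega
    · simp only; omega
    · rw [ne_eq, Fin.mk.injEq]; omega
  · intro h
    rw [mem_pendantVertices_iff]
    rcases h with h | h
    · refine ⟨⟨1, by omega⟩, broom_adj.2 (.inl ⟨by simp only; omega, by simp only; omega⟩), ?_⟩
      intro j hj
      have := broom_adj.1 hj
      ext
      simp only
      omega
    · refine ⟨⟨m, by omega⟩, broom_adj.2 (.inr ⟨by simp only; omega, by simp only; omega⟩), ?_⟩
      intro j hj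
      have := broom_adj.1 hj
      ext
      simp only
      omega

theorem broom_mem_treesWithPendants {n k : ℕ} (hk : 2 ≤ k) (hkn : k + 2 ≤ n) :
    broom n (n - k) ∈ treesWithPendants n k := by
  refine ⟨broom_isTree (by omega), ?_⟩
  -- The non-pendant vertices are exactly `1, …, n - k`, hence `k` vertices are pendant.
  have hcompl : (pendantVertices (broom n (n - k)))ᶜ.card = n - k := by
    have : ((pendantVertices (broom n (n - k)))ᶜ).map Fin.valEmbedding = Finset.Icc 1 (n - k) := by
      ext i
      simp only [Finset.mem_map, Finset.mem_compl, Fin.valEmbedding_apply, Finset.mem_Icc,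
        mem_pendantVertices_broom (show 1 ≤ n - k by omega) (show n - k + 1 < n by omega)]
      constructor
      · rintro ⟨j, hj, rfl⟩; omega
      · intro hi
        exact ⟨⟨i, by omega⟩, by simp only; omega, rfl⟩
    rw [← Finset.card_map Fin.valEmbedding, this, Nat.card_Icc]
    omega
  have := Finset.card_compl_add_card (pendantVertices (broom n (n - k)))
  rw [Fintype.card_fin] at this
  omega

end DistSignless

theorem theorem3p3 (n k : ℕ) (hk : 2 ≤ k) (hkn : k + 2 ≤ n) :
    (∃ T ∈ DistSignless.treesWithPendants n k,
      IsMaxOn DistSignless.rhoQ (DistSignless.treesWithPendants n k) T) ∧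
    ∀ T ∈ DistSignless.treesWithPendants n k,
      IsMaxOn DistSignless.rhoQ (DistSignless.treesWithPendants n k) T →
      DistSignless.InClassD n k T := by
  refine ⟨?_, fun T hT hmax => ?_⟩
  · exact Set.exists_max_image _ DistSignless.rhoQ (Set.toFinite _)
      ⟨_, DistSignless.broom_mem_treesWithPendants hk hkn⟩
  · have h := DistSignless.inClassD_of_forall_adj hT.1 (by rw [hT.2, Fintype.card_fin]; exact hkn)
      fun w b c c' hwc hwc' hcc' hc hc' hwb =>
        DistSignless.adj_eq_or_eq_of_isMaxOn hT hmax hwc hwc' hcc' hc hc' hwb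
    rwa [hT.2, Fintype.card_fin] at h
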